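/- Let $n\ge 0$ be an integer. Write a permutation of $12\ldots n$ as a word $a_1a_2\ldots a_n$; its reversal is the word $a_n\ldots a_2a_1$. An adjacent-interchange Gray code for the permutations of $12\ldots n$ is a listing of all $n!$ of these words, each exactly once, in which any two consecutive words differ by the interchange of the symbols in two adjacent positions. It is called reverse if, for every $i$ with $1\le i$ and $i+\lfloor n!/2\rfloor\le n!$, the $(i+\lfloor n!/2\rfloor)$-th word is the reversal of the $i$-th word. (For $n\geq 2$ the number $n!/2$ is an integer; for $n\le 1$ there is only one word, and it is its own reversal.) A reverse adjacent-interchange Gray code for the permutations of $12\ldots n$ exists if and only if $n\le 4$ or $n\equiv 0,1\pmod 4$. Moreover, whenever $n\le 4$ or $n\equiv 0,1\pmod 4$, there is such a code whose first word is $12\ldots n$ and, if $n\ge 2$, whose first $n!/2$ words are exactly the permutations in which $1$ precedes $2$. -/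

import Mathlib

open scoped Nat

namespace ReverseGray

/-- A permutation `a₁a₂…aₙ` of `12…n`, in one-line notation: `w p` is the symbol in position `p`.
Positions and symbols are numbered from `0`, so the symbol `k` of the text is `k - 1` here, and the
word `12…n` is the identity `1`. -/
abbrev Word (n : ℕ) : Type := Equiv.Perm (Fin n)

/-- The words `v` and `w` differ by interchanging the symbols in two adjacent positions. -/
def AdjacentInterchange {n : ℕ} (v w : Word n) : Prop :=
  ∃ p q : Fin n, (q : ℕ) = (p : ℕ) + 1 ∧
    w p = v q ∧ w q = v p ∧ ∀ r : Fin n, r ≠ p → r ≠ q → w r = v r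

/-- The reversal `aₙ…a₂a₁` of the word `a₁a₂…aₙ`. -/
def reversal {n : ℕ} (w : Word n) : Word n := Fin.revPerm.trans w

/-- An adjacent-interchange Gray code for the permutations of `12…n`: a listing of all `n!`
permutations, each exactly once, such that consecutive ones differ by an adjacent interchange. -/
structure IsGrayCode {n : ℕ} (c : Fin (n !) → Word n) : Prop where
  bijective : Function.Bijective c
  adjacent : ∀ i j : Fin (n !), (j : ℕ) = (i : ℕ) + 1 → AdjacentInterchange (c i) (c j)

/-- A reverse adjacent-interchange Gray code: the `(i + n!/2)`-th permutation is the reversal of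
the `i`-th. (For `n ≥ 2` the division is exact. For `n ≤ 1` there is a single permutation, it is
its own reversal, and `n ! / 2` is `0`.) -/
structure IsReverseGrayCode {n : ℕ} (c : Fin (n !) → Word n) : Prop extends IsGrayCode c where
  reverse : ∀ i j : Fin (n !), (j : ℕ) = (i : ℕ) + n ! / 2 → c j = reversal (c i)

/-- The listing starts with `12…n`, and its first `n!/2` permutations are exactly those in which
the symbol `1` precedes the symbol `2` (for `n ≥ 2`, so that both symbols are present). -/
structure StartsWithOneBeforeTwo {n : ℕ} (c : Fin (n !) → Word n) : Prop where
  first : ∀ i : Fin (n !), (i : ℕ) = 0 → c i = 1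
  firstHalf : ∀ one two : Fin n, (one : ℕ) = 0 → (two : ℕ) = 1 →
    ∀ i : Fin (n !), (i : ℕ) < n ! / 2 ↔ (c i).symm one < (c i).symm two

end ReverseGray

/-! Necessity is a matter of signs. Each adjacent interchange changes the sign, so for `n ≥ 4`,
where `n!/2` is even, the first word and the word `n!/2` places later have equal signs. They are
reversals of each other, and reversal multiplies the sign by `(-1)^(n.choose 2)`. Hence `n.choose 2`
is even, that is, `n ≡ 0, 1 (mod 4)`.

For existence it suffices to find a Hamilton path from `12…n` to `n…312` through the words in which
`1` precedes `2`. One interchange leads from its end to `n…321`, the reversal of its beginning, so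
the path can be followed by its own reversal (`exists_code`). If `n ≡ 0, 1 (mod 4)`, the two ends
have opposite parity, and for `n ≥ 5` such a path is a case of `Laceable`, proved by induction on
the number of symbols.

In the inductive step (`Laceable.step`) the words are divided into classes by first symbol; each
class is a smaller instance. If the ends lie in different classes, the classes are visited one after
another, moving from `xyt` to `yxt`, where the parity of `t` can be chosen freely
(`exists_path_heads`). If both ends lie in class `x`, a Hamilton path of that class is cut at an
edge `xyzt, xzyt`, and a detour from `yxzt` to `zxyt` through all other classes is inserted. This
needs an edge with `y, z ≠ b`, which explains the clause of `Laceable` on changes of the first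
entry; that it allows any excluded symbol `s` lets it pass through the induction.

The base cases, four unconstrained symbols or five symbols with one precedence, are verified by
computation on stored routes. Words with `n ≤ 4` are handled directly. -/

namespace ReverseGray

/-! ### Adjacent interchanges and inversion parity of lists -/

/-- Interchange of two adjacent entries of a list. -/
inductive Adj : List ℕ → List ℕ → Prop
  | swap (x y : ℕ) (l : List ℕ) : Adj (x :: y :: l) (y :: x :: l)
  | cons (x : ℕ) {u v : List ℕ} : Adj u v → Adj (x :: u) (x :: v)

/-- The number of inversions of a list. -/
def inv : List ℕ → ℕ
  | [] => 0
  | x :: l => l.countP (· < x) + inv l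

/-- The arrangements of `A` in which `b` does not precede `a`. -/
def IsWord (a b : ℕ) (A : Finset ℕ) (w : List ℕ) : Prop :=
  w.Nodup ∧ w.toFinset = A ∧ ¬ [b, a].Sublist w

/-- A path from `u` to `v` without repetitions in the graph of adjacent interchanges. -/
structure IsPath (u v : List ℕ) (P : List (List ℕ)) : Prop where
  chain : P.IsChain Adj
  head : P.head? = some u
  last : P.getLast? = some v
  nodup : P.Nodup

/-- Between consecutive words of `P` the first entry changes once from `x` to `y`. -/
def Turns (P : List (List ℕ)) (x y : ℕ) : Prop :=
  ∃ w₁ w₂, [x :: w₁, y :: w₂] <:+: P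

/-- Words of opposite parity are joined by a Hamilton path, on which the first entry changes at
least once from and to symbols other than a prescribed `s`. -/
def Laceable (a b : ℕ) (A : Finset ℕ) : Prop :=
  ∀ u v, IsWord a b A u → IsWord a b A v → (inv u + inv v) % 2 = 1 → ∀ s,
    ∃ P, IsPath u v P ∧ (∀ w, w ∈ P ↔ IsWord a b A w) ∧
      ∃ x y, x ≠ y ∧ x ≠ s ∧ y ≠ s ∧ Turns P x y

theorem Adj.perm {u v : List ℕ} (h : Adj u v) : u.Perm v := by
  induction h with
  | swap x y l => exact .swap y x l
  | cons x _ ih => exact .cons x ih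

theorem Adj.append_left {u v : List ℕ} (h : Adj u v) (l : List ℕ) : Adj (l ++ u) (l ++ v) := by
  induction l with
  | nil => exact h
  | cons x l ih => exact .cons x ih

theorem Adj.reverse {u v : List ℕ} (h : Adj u v) : Adj u.reverse v.reverse := by
  have append_right : ∀ {u v : List ℕ}, Adj u v → ∀ r, Adj (u ++ r) (v ++ r) := by
    intro u v h r
    induction h with
    | swap x y l => exact .swap x y (l ++ r)
    | cons x _ ih => exact .cons x ih
  induction h with
  | swap x y l =>
    simpa using (Adj.swap y x []).append_left l.reverse
  | cons x _ ih => simpa using append_right ih [x]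

theorem Adj.map {u v : List ℕ} (h : Adj u v) (f : ℕ → ℕ) : Adj (u.map f) (v.map f) := by
  induction h with
  | swap x y l => exact .swap _ _ _
  | cons x _ ih => exact .cons _ ih

theorem Adj.exists_swap {u v : List ℕ} (h : Adj u v) :
    ∃ l x y r, u = l ++ x :: y :: r ∧ v = l ++ y :: x :: r := by
  induction h with
  | swap x y l => exact ⟨[], x, y, l, rfl, rfl⟩
  | cons x _ ih =>
    obtain ⟨l, y, z, r, rfl, rfl⟩ := ih
    exact ⟨x :: l, y, z, r, rfl, rfl⟩

theorem Adj.eq_of_head_ne {x y : ℕ} {u v : List ℕ} (h : Adj (x :: u) (y :: v)) (hxy : x ≠ y) :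
    ∃ t, u = y :: t ∧ v = x :: t := by
  cases h with
  | swap x y l => exact ⟨l, rfl, rfl⟩
  | cons x _ => exact absurd rfl hxy

/-- Only the relative order of `x` and `y` changes, so the two counts differ by one. -/
theorem inv_swap {x y : ℕ} (l : List ℕ) (h : x ≠ y) :
    (inv (x :: y :: l) + inv (y :: x :: l)) % 2 = 1 := by
  simp only [inv, List.countP_cons]
  rcases lt_or_gt_of_ne h with h | h
  · simp [h, h.le.not_gt]; omega
  · simp [h, h.le.not_gt]; omega

theorem inv_cons_add_inv_cons {u v : List ℕ} (h : u.Perm v) (x : ℕ) :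
    (inv (x :: u) + inv (x :: v)) % 2 = (inv u + inv v) % 2 := by
  simp only [inv, h.countP_eq]; omega

theorem Adj.inv {u v : List ℕ} (h : Adj u v) (hu : u.Nodup) :
    (ReverseGray.inv u + ReverseGray.inv v) % 2 = 1 := by
  induction h with
  | swap x y l => exact inv_swap l (by rintro rfl; simp at hu)
  | cons x h ih =>
    rw [inv_cons_add_inv_cons h.perm, ih (List.nodup_cons.1 hu).2]

/-- Relabelling preserves relative parity. -/
theorem inv_map {u v : List ℕ} (h : u.Perm v) (f : ℕ → ℕ) (hf : (u.map f).Nodup) :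
    (inv (u.map f) + inv (v.map f)) % 2 = (inv u + inv v) % 2 := by
  induction h with
  | nil => rfl
  | cons x h ih =>
    rw [List.map_cons] at hf
    rw [inv_cons_add_inv_cons h, List.map_cons, List.map_cons, inv_cons_add_inv_cons (h.map f),
      ih (List.nodup_cons.1 hf).2]
  | swap x y l =>
    simp only [List.map_cons, List.nodup_cons, List.mem_cons, not_or] at hf
    rw [inv_swap l (fun h => hf.1.1 (congrArg f h)), List.map_cons, List.map_cons, List.map_cons,
      List.map_cons, inv_swap _ hf.1.1]
  | trans h₁ h₂ ih₁ ih₂ =>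
    have := ih₁ hf
    have := ih₂ ((h₁.map f).nodup_iff.1 hf)
    omega

theorem inv_append_singleton (l : List ℕ) (x : ℕ) :
    inv (l ++ [x]) = inv l + l.countP (x < ·) := by
  induction l with
  | nil => simp [inv]
  | cons y l ih => simp [inv, ih, List.countP_append, List.countP_cons]; omega

/-- Each pair of entries is inverted in exactly one of the two lists. -/
theorem inv_reverse {l : List ℕ} (h : l.Nodup) :
    inv l.reverse + inv l = l.length.choose 2 := by
  induction l with
  | nil => rfl
  | cons x l ih =>
    have hx := List.nodup_cons.1 h
    have key : l.countP (· < x) + l.countP (x < ·) = l.length := by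
      rw [List.length_eq_countP_add_countP (· < x)]
      congr 1
      refine List.countP_congr fun y hy => ?_
      have : x ≠ y := fun e => hx.1 (e ▸ hy)
      simp; omega
    rw [List.reverse_cons, inv_append_singleton, List.length_cons, Nat.choose_succ_succ' _ 1,
      ← ih hx.2, Nat.choose_one_right, inv, (List.reverse_perm l).countP_eq]
    omega

/-! ### Words under a precedence constraint, and paths of words -/

section Lists

variable {a b : ℕ} {A : Finset ℕ} {u v w : List ℕ} {x y : ℕ}

theorem IsWord.perm (hu : IsWord a b A u) (hv : IsWord a b A v) : u.Perm v :=
  List.perm_of_nodup_nodup_toFinset_eq hu.1 hv.1 (hu.2.1.trans hv.2.1.symm)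

/-- This is the recursion behind the division into classes: `b` may come first only if no `a`
remains to follow it, and the tail obeys the same constraint on the remaining symbols. -/
theorem isWord_cons (hab : a ≠ b) :
    IsWord a b A (x :: w) ↔ x ∈ A ∧ (x = b → a ∉ A) ∧ IsWord a b (A.erase x) w := by
  constructor
  · rintro ⟨h1, rfl, h3⟩
    have hx := List.nodup_cons.1 h1
    refine ⟨by simp, ?_, hx.2, ?_, fun h => h3 (h.cons x)⟩
    · rintro rfl h
      have : a ∈ w := by simpa [hab] using h
      exact h3 ((List.singleton_sublist.2 this).cons_cons x)
    · rw [List.toFinset_cons, Finset.erase_insert (by simpa using hx.1)]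
  · rintro ⟨h1, h2, h3, h4, h5⟩
    have hx : x ∉ w := by rw [← List.mem_toFinset, h4]; simp
    refine ⟨List.nodup_cons.2 ⟨hx, h3⟩, ?_, ?_⟩
    · rw [List.toFinset_cons, h4, Finset.insert_erase h1]
    · intro h
      cases h with
      | cons _ h => exact h5 h
      | cons_cons _ h =>
        refine h2 rfl (Finset.mem_of_mem_erase (a := b) ?_)
        rw [← h4]
        simpa using h

theorem IsWord.swap (hab : a ≠ b) (h : IsWord a b A (x :: y :: w)) (hy : y = b → a ∉ A) :
    IsWord a b A (y :: x :: w) := by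
  rw [isWord_cons hab, isWord_cons hab] at h ⊢
  rw [Finset.erase_right_comm]
  obtain ⟨h1, h2, h3, h4, h5⟩ := h
  have := Finset.mem_erase.1 h3
  exact ⟨this.2, hy, Finset.mem_erase.2 ⟨this.1.symm, h1⟩,
    fun e ha => h2 e (Finset.mem_of_mem_erase ha), h5⟩

/-- Arrangements of both parities exist. -/
theorem exists_isWord (hab : a ≠ b) (hA : 3 ≤ A.card) (i : ℕ) :
    ∃ w, IsWord a b A w ∧ (inv w + i) % 2 = 1 := by
  -- With `a` placed first whenever it occurs, the tail is free of constraint, and interchanging two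
  -- of its entries switches the parity.
  obtain ⟨x, hx, hxa, hxb⟩ : ∃ x ∈ A, a ∉ A.erase x ∧ (x = b → a ∉ A) := by
    by_cases ha : a ∈ A
    · exact ⟨a, ha, by simp, fun h => absurd h hab⟩
    · obtain ⟨x, hx⟩ := Finset.card_pos.1 (by omega : 0 < A.card)
      exact ⟨x, hx, fun h => ha (Finset.mem_of_mem_erase h), fun _ => ha⟩
  have hword : ∀ w : List ℕ, w.Perm (A.erase x).toList → IsWord a b A (x :: w) := by
    intro w hw
    have hm : ∀ y, y ∈ w ↔ y ∈ A.erase x := fun y => by rw [hw.mem_iff, Finset.mem_toList]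
    refine (isWord_cons hab).2 ⟨hx, hxb, hw.nodup_iff.2 (Finset.nodup_toList _), ?_, ?_⟩
    · ext y; rw [List.mem_toFinset, hm]
    · exact fun h => hxa ((hm a).1 (h.subset (by simp)))
  have hlen : 2 ≤ (A.erase x).toList.length := by
    rw [Finset.length_toList, Finset.card_erase_of_mem hx]; omega
  have hnodup := (A.erase x).nodup_toList
  revert hword hlen hnodup
  rcases (A.erase x).toList with _ | ⟨p, _ | ⟨q, l⟩⟩
  · simp
  · simp
  · intro hword _ hnodup
    have hpq : p ≠ q := by rintro rfl; simp at hnodup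
    have h1 := inv_cons_add_inv_cons (List.Perm.swap q p l) x
    rw [inv_swap l hpq] at h1
    by_cases h : (inv (x :: p :: q :: l) + i) % 2 = 1
    · exact ⟨_, hword _ (.refl _), h⟩
    · exact ⟨_, hword _ (.swap p q l), by omega⟩

theorem IsPath.append {u' v' : List ℕ} {P Q : List (List ℕ)} (hP : IsPath u v P)
    (hQ : IsPath u' v' Q) (h : Adj v u') (hd : ∀ w ∈ P, w ∉ Q) : IsPath u v' (P ++ Q) where
  chain := by
    refine List.isChain_append.2 ⟨hP.chain, hQ.chain, ?_⟩
    rw [hP.last, hQ.head]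
    rintro _ ⟨⟩ _ ⟨⟩
    exact h
  head := by rw [List.head?_append, hP.head]; rfl
  last := by rw [List.getLast?_append, hQ.last]; rfl
  nodup := List.nodup_append'.2 ⟨hP.nodup, hQ.nodup, fun w h1 h2 => hd w h1 h2⟩

theorem IsPath.map {P : List (List ℕ)} (hP : IsPath u v P) (f : List ℕ → List ℕ)
    (hf : ∀ w₁ w₂, Adj w₁ w₂ → Adj (f w₁) (f w₂)) (hi : ∀ w₁ ∈ P, ∀ w₂ ∈ P, f w₁ = f w₂ → w₁ = w₂) :
    IsPath (f u) (f v) (P.map f) where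
  chain := (List.isChain_map f).2 (hP.chain.imp hf)
  head := by rw [List.head?_map, hP.head]; rfl
  last := by rw [List.getLast?_map, hP.last]; rfl
  nodup := hP.nodup.map_on fun w₁ h₁ w₂ h₂ => hi w₁ h₁ w₂ h₂

theorem IsPath.cons {P : List (List ℕ)} (hP : IsPath u v P) (x : ℕ) :
    IsPath (x :: u) (x :: v) (P.map (x :: ·)) :=
  hP.map _ (fun _ _ => .cons x) fun _ _ _ _ h => (List.cons.inj h).2

/-- Cuts a path at one of its edges, for the insertion of a detour. -/
theorem IsPath.of_append {P Q : List (List ℕ)} {p q : List ℕ}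
    (h : IsPath u v (P ++ [p, q] ++ Q)) :
    IsPath u p (P ++ [p]) ∧ IsPath q v (q :: Q) ∧ Adj p q ∧ ∀ w ∈ P ++ [p], w ∉ q :: Q := by
  have e : P ++ [p, q] ++ Q = (P ++ [p]) ++ (q :: Q) := by simp
  rw [e] at h
  obtain ⟨h1, h2, h3, h4⟩ := h
  obtain ⟨c1, c2, c3⟩ := List.isChain_append.1 h1
  obtain ⟨d1, d2, d3⟩ := List.nodup_append'.1 h4
  refine ⟨⟨c1, ?_, by simp, d1⟩, ⟨c2, rfl, ?_, d2⟩, c3 p (by simp) q (by simp),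
    fun w h1 h2 => d3 h1 h2⟩
  · rw [← h2]; cases P <;> simp
  · rw [← h3, List.getLast?_append]; simp [List.getLast?_cons]

theorem Turns.mono {P Q : List (List ℕ)} (h : Turns P x y) (hPQ : P <:+: Q) : Turns Q x y :=
  let ⟨w₁, w₂, hw⟩ := h
  ⟨w₁, w₂, hw.trans hPQ⟩

theorem Turns.append {P Q : List (List ℕ)} (hP : P.getLast? = some (x :: u))
    (hQ : Q.head? = some (y :: v)) : Turns (P ++ Q) x y := by
  obtain ⟨P, rfl⟩ := List.getLast?_eq_some_iff.1 hP
  obtain ⟨Q, rfl⟩ := List.head?_eq_some_iff.1 hQ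
  exact ⟨u, v, P, Q, by simp⟩

/-! ### The inductive step for laceability -/

/-- Words of both parities begin with any two given symbols. -/
theorem exists_isWord_cons_cons (hab : a ≠ b) (hA : 5 ≤ A.card) (hx : x ∈ A) (hxb : x = b → a ∉ A)
    (hy : y ∈ A) (hyb : y = b → a ∉ A) (hxy : x ≠ y) (i : ℕ) :
    ∃ w, IsWord a b A (x :: y :: w) ∧ (inv (x :: y :: w) + i) % 2 = 1 := by
  have hy' : y ∈ A.erase x := Finset.mem_erase.2 ⟨hxy.symm, hy⟩
  have hcard : 3 ≤ ((A.erase x).erase y).card := by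
    rw [Finset.card_erase_of_mem hy', Finset.card_erase_of_mem hx]; omega
  have hcons : ∀ w, IsWord a b ((A.erase x).erase y) w → IsWord a b A (x :: y :: w) := fun w hw =>
    (isWord_cons hab).2 ⟨hx, hxb, (isWord_cons hab).2
      ⟨hy', fun h ha => hyb h (Finset.mem_of_mem_erase ha), hw⟩⟩
  obtain ⟨w₀, h₀, p₀⟩ := exists_isWord hab hcard 0
  obtain ⟨w₁, h₁, p₁⟩ := exists_isWord hab hcard 1
  have h := inv_cons_add_inv_cons ((h₀.perm h₁).cons y) x
  rw [inv_cons_add_inv_cons (h₀.perm h₁) y] at h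
  by_cases hi : (inv (x :: y :: w₀) + i) % 2 = 1
  · exact ⟨w₀, hcons _ h₀, hi⟩
  · exact ⟨w₁, hcons _ h₁, by omega⟩

theorem mem_map_cons_iff (hab : a ≠ b) (hx : x ∈ A) (hxb : x = b → a ∉ A) {P : List (List ℕ)}
    (hP : ∀ w, w ∈ P ↔ IsWord a b (A.erase x) w) (w : List ℕ) :
    w ∈ P.map (x :: ·) ↔ IsWord a b A w ∧ w.head? = some x := by
  constructor
  · intro h
    obtain ⟨t, ht, rfl⟩ := List.mem_map.1 h
    exact ⟨(isWord_cons hab).2 ⟨hx, hxb, (hP t).1 ht⟩, rfl⟩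
  · rintro ⟨hw, h⟩
    obtain ⟨t, rfl⟩ := List.head?_eq_some_iff.1 h
    exact List.mem_map.2 ⟨t, (hP t).2 ((isWord_cons hab).1 hw).2.2, rfl⟩

/-- A path running in turn through the classes of words that begin with the entries of `x :: X`. -/
theorem exists_path_heads (hab : a ≠ b) (hA : 5 ≤ A.card) (X : List ℕ) :
    ∀ x z u v, (x :: X).Nodup → (x :: X).getLast? = some z →
      (∀ y ∈ x :: X, y ∈ A ∧ (y = b → a ∉ A) ∧ Laceable a b (A.erase y)) →
      IsWord a b A (x :: u) → IsWord a b A (z :: v) → (inv (x :: u) + inv (z :: v)) % 2 = 1 →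
      ∃ P, IsPath (x :: u) (z :: v) P ∧
        (∀ w, w ∈ P ↔ IsWord a b A w ∧ ∃ y ∈ x :: X, w.head? = some y) ∧
        ∀ p q, [p, q] <:+: x :: X → Turns P p q := by
  induction X with
  | nil =>
    intro x z u v _ hz hX hu hv hodd
    obtain rfl : x = z := by simpa using hz
    have hu' := ((isWord_cons hab).1 hu).2.2
    have hv' := ((isWord_cons hab).1 hv).2.2
    -- Only the path is needed here, so the excluded symbol `0` is a dummy.
    obtain ⟨P, hP, hm, -⟩ := (hX x (by simp)).2.2 u v hu' hv'
      (by rwa [inv_cons_add_inv_cons (hu'.perm hv')] at hodd) 0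
    refine ⟨_, hP.cons x, fun w => ?_, fun p q h => by simpa using h.length_le⟩
    have hx := hX x (by simp)
    simp [mem_map_cons_iff hab hx.1 hx.2.1 hm]
  | cons y X ih =>
    intro x z u v hd hz hX hu hv hodd
    have hxy : x ≠ y := by rintro rfl; simp at hd
    have hx := hX x (by simp)
    have hy := hX y (by simp)
    have hu' := (isWord_cons hab).1 hu
    -- The exit `x :: y :: t` has parity opposite to the entry `x :: u`. The next entry `y :: x ::
    -- t` then has the parity of `x :: u` again, so it is still opposite to the final word.
    obtain ⟨t, ht, hti⟩ := exists_isWord_cons_cons hab hA hx.1 hx.2.1 hy.1 hy.2.1 hxy (inv (x :: u))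
    have ht' := (isWord_cons hab).1 ht
    have hswap : Adj (x :: y :: t) (y :: x :: t) := .swap x y t
    have hinv := hswap.inv ht.1
    have htu := inv_cons_add_inv_cons (hu'.2.2.perm ht'.2.2) x
    obtain ⟨P, hP, hPm, -⟩ := hx.2.2 u (y :: t) hu'.2.2 ht'.2.2 (by omega) 0
    obtain ⟨Q, hQ, hQm, hQt⟩ := ih y z (x :: t) v hd.of_cons (by simpa using hz)
      (fun p hp => hX p (List.mem_cons_of_mem _ hp)) (ht.swap hab hy.2.1) hv (by omega)
    refine ⟨P.map (x :: ·) ++ Q, (hP.cons x).append hQ hswap ?_, fun w => ?_, fun p q hpq => ?_⟩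
    · intro w hw hw'
      obtain ⟨w, -, rfl⟩ := List.mem_map.1 hw
      obtain ⟨-, p, hp, hp'⟩ := (hQm _).1 hw'
      obtain rfl : x = p := by simpa using hp'
      exact (List.nodup_cons.1 hd).1 hp
    · rw [List.mem_append, mem_map_cons_iff hab hx.1 hx.2.1 hPm, hQm, ← and_or_left]
      simp only [List.mem_cons, exists_eq_or_imp]
    · rcases List.infix_cons_iff.1 hpq with h | h
      · obtain ⟨hp, h⟩ := List.cons_prefix_cons.1 h
        obtain ⟨hq, -⟩ := List.cons_prefix_cons.1 h
        rw [hp, hq]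
        exact .append (hP.cons x).last hQ.head
      · exact (hQt p q h).mono (List.suffix_append _ _).isInfix

/-- The elements of a finite set with at least four elements in an order with prescribed ends. -/
theorem exists_order {H : Finset ℕ} (hxy : x ≠ y) (hx : x ∈ H) (hy : y ∈ H) (hH : 4 ≤ H.card)
    (s : ℕ) :
    ∃ X, (x :: X).Nodup ∧ (x :: X).getLast? = some y ∧ (∀ p, p ∈ x :: X ↔ p ∈ H) ∧
      ∃ p q, p ≠ q ∧ p ≠ s ∧ q ≠ s ∧ [p, q] <:+: x :: X := by
  have hlen : 2 ≤ ((H.erase x).erase y).toList.length := by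
    rw [Finset.length_toList, Finset.card_erase_of_mem (Finset.mem_erase.2 ⟨hxy.symm, hy⟩),
      Finset.card_erase_of_mem hx]
    omega
  have hd := ((H.erase x).erase y).nodup_toList
  have hm : ∀ p, p ∈ ((H.erase x).erase y).toList ↔ p ≠ y ∧ p ≠ x ∧ p ∈ H := by simp
  revert hlen hd hm
  rcases ((H.erase x).erase y).toList with _ | ⟨r, R⟩
  · simp
  rcases R.eq_nil_or_concat with rfl | ⟨R, r', rfl⟩
  · simp
  rw [List.concat_eq_append]
  intro _ hd hm
  have hr := (hm r).1 (by simp)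
  have hr' := (hm r').1 (by simp)
  have hrr : r ≠ r' := by rintro rfl; simp at hd
  refine ⟨r :: (R ++ [r']) ++ [y], ?_, List.getLast?_concat (l := x :: r :: (R ++ [r'])), fun p => ?_, ?_⟩
  · refine List.nodup_cons.2 ⟨?_, List.nodup_append'.2 ⟨hd, List.nodup_singleton y, ?_⟩⟩
    · rw [List.mem_append, hm, List.mem_singleton]
      tauto
    · intro p hp hp'
      exact ((hm p).1 hp).1 (List.mem_singleton.1 hp')
  · rw [List.mem_cons, List.mem_append, hm, List.mem_singleton]
    by_cases hpx : p = x
    · simp [hpx, hx]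
    · by_cases hpy : p = y <;> simp [hpx, hpy, hy]
  -- The order is `x, r, …, r', y`. The pairs `x, r` and `r', y` are disjoint, so one of them avoids
  -- `s`.
  · by_cases hs : s = x ∨ s = r
    · refine ⟨r', y, hr'.1, ?_, ?_, x :: r :: R, [], by simp⟩ <;> rcases hs with rfl | rfl
      exacts [hr'.2.1, hrr.symm, hxy.symm, hr.1.symm]
    · push Not at hs
      exact ⟨x, r, hr.2.1.symm, hs.1.symm, hs.2.symm, [], R ++ [r'] ++ [y], by simp⟩

/-- Laceability is inherited from the classes of words with a given first symbol. -/
theorem Laceable.step (hab : a ≠ b) (hA : 5 ≤ A.card)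
    (hA' : a ∈ A → b ∈ A → 6 ≤ A.card)
    (ih : ∀ x ∈ A, (x = b → a ∉ A) → Laceable a b (A.erase x)) : Laceable a b A := by
  set H := A.filter fun x => x = b → a ∉ A with hH
  have memH : ∀ x, x ∈ H ↔ x ∈ A ∧ (x = b → a ∉ A) := fun x => Finset.mem_filter
  have cardH : 5 ≤ H.card := by
    by_cases h : a ∈ A ∧ b ∈ A
    -- Under an effective constraint no word begins with `b`; this loses one class and accounts for
    -- the bound `6`.
    · have : H = A.erase b := by ext x; rw [memH, Finset.mem_erase]; grind
      rw [this, Finset.card_erase_of_mem h.2]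
      have := hA' h.1 h.2
      omega
    · have : H = A := by ext x; rw [memH]; grind
      rwa [this]
  have hX : ∀ x ∈ H, x ∈ A ∧ (x = b → a ∉ A) ∧ Laceable a b (A.erase x) := fun x hx =>
    ⟨((memH x).1 hx).1, ((memH x).1 hx).2, ih x ((memH x).1 hx).1 ((memH x).1 hx).2⟩
  have headH : ∀ x w, IsWord a b A (x :: w) → x ∈ H := fun x w hw =>
    have := (isWord_cons hab).1 hw
    (memH x).2 ⟨this.1, this.2.1⟩
  intro u v hu hv hodd s
  have hne : A.Nonempty := Finset.card_pos.1 (by omega)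
  rcases u with _ | ⟨x, u⟩
  · exact absurd hu.2.1.symm hne.ne_empty
  rcases v with _ | ⟨z, v⟩
  · exact absurd hv.2.1.symm hne.ne_empty
  by_cases hxz : x = z
  · subst z
    have hu' := (isWord_cons hab).1 hu
    have hv' := (isWord_cons hab).1 hv
    -- With `b` as the excluded symbol, the edge found has `y, z ≠ b`, so `x` may be interchanged
    -- with either of them without breaking the constraint.
    obtain ⟨P, hP, hPm, y, z, hyz, hyb, hzb, t, t', Q₁, Q₂, rfl⟩ := ih x hu'.1 hu'.2.1 u v hu'.2.2 hv'.2.2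
      (by rwa [inv_cons_add_inv_cons (hu'.2.2.perm hv'.2.2)] at hodd) b
    have hm := mem_map_cons_iff hab hu'.1 hu'.2.1 hPm
    obtain ⟨hP₁, hP₂, hadj, hdisj⟩ := hP.of_append
    obtain ⟨t, rfl, rfl⟩ := hadj.eq_of_head_ne hyz
    have hy : IsWord a b A (x :: y :: z :: t) := ((hm _).1 (List.mem_map_of_mem (by simp))).1
    have hz : IsWord a b A (x :: z :: y :: t) := ((hm _).1 (List.mem_map_of_mem (by simp))).1
    have hy' := hy.swap hab (fun h => absurd h hyb)
    have hz' := hz.swap hab (fun h => absurd h hzb)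
    have hadjy : Adj (x :: y :: z :: t) (y :: x :: z :: t) := .swap _ _ _
    have hadjz : Adj (z :: x :: y :: t) (x :: z :: y :: t) := .swap _ _ _
    -- The ends of the detour are three interchanges apart, through the two ends of the cut edge.
    have hodd' : (inv (y :: x :: z :: t) + inv (z :: x :: y :: t)) % 2 = 1 := by
      have h₁ := hadjy.inv hy.1
      have h₂ := hadjz.inv hz'.1
      have h₃ := (hadj.cons x).inv hy.1
      omega
    have hyH := headH _ _ hy'
    have hzH := headH _ _ hz'
    have hxH := headH _ _ hy
    have hxy : x ≠ y := by rintro rfl; simpa using hy.1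
    have hxz : x ≠ z := by rintro rfl; simpa using hz.1
    obtain ⟨X, hXd, hXl, hXm, p, q, hpq, hps, hqs, hpqX⟩ := exists_order hyz
      (Finset.mem_erase.2 ⟨hxy.symm, hyH⟩) (Finset.mem_erase.2 ⟨hxz.symm, hzH⟩)
      (by rw [Finset.card_erase_of_mem hxH]; omega) s
    obtain ⟨R, hR, hRm, hRt⟩ := exists_path_heads hab hA X y z _ _ hXd hXl
      (fun p hp => hX p (Finset.mem_of_mem_erase ((hXm p).1 hp))) hy' hz' hodd'
    have hRx : ∀ w ∈ R, w.head? ≠ some x := by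
      intro w hw e
      obtain ⟨-, p, hp, hp'⟩ := (hRm w).1 hw
      obtain rfl : x = p := by simpa [e] using hp'
      simpa using (hXm x).1 hp
    have hcx : ∀ {T : List (List ℕ)} {w}, w ∈ T.map (x :: ·) → w.head? = some x := by
      intro T w hw
      obtain ⟨w, -, rfl⟩ := List.mem_map.1 hw
      rfl
    have hD := (hP₁.cons x).append hR hadjy fun w hw hw' => hRx w hw' (hcx hw)
    have hE := hD.append (hP₂.cons x) hadjz fun w hw hw' => by
      rcases List.mem_append.1 hw with h | h
      · obtain ⟨w₁, h₁, rfl⟩ := List.mem_map.1 h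
        obtain ⟨w₂, h₂, h₃⟩ := List.mem_map.1 hw'
        obtain rfl := (List.cons.inj h₃).2
        exact hdisj _ h₁ h₂
      · exact hRx w h (hcx hw')
    refine ⟨_, hE, fun w => ?_, ?_⟩
    · have hw := hm w
      have hh : IsWord a b A w → ∃ y ∈ H, w.head? = some y := by
        intro hw
        rcases w with _ | ⟨y, w⟩
        · exact absurd hw.2.1.symm hne.ne_empty
        · exact ⟨y, headH _ _ hw, rfl⟩
      have e : w ∈ (Q₁ ++ [y :: z :: t]).map (x :: ·) ++ R ++ ((z :: y :: t) :: Q₂).map (x :: ·) ↔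
          w ∈ (Q₁ ++ [y :: z :: t, z :: y :: t] ++ Q₂).map (x :: ·) ∨ w ∈ R := by
        rw [show Q₁ ++ [y :: z :: t, z :: y :: t] ++ Q₂ =
          (Q₁ ++ [y :: z :: t]) ++ ((z :: y :: t) :: Q₂) by simp, List.map_append (l₂ := _ :: Q₂),
          List.mem_append, List.mem_append, List.mem_append, or_right_comm]
      rw [e, hw, hRm]
      constructor
      · rintro (h | h) <;> exact h.1
      · intro h
        obtain ⟨p, hp, hp'⟩ := hh h
        by_cases hpx : p = x
        · exact Or.inl ⟨h, hpx ▸ hp'⟩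
        · exact Or.inr ⟨h, p, (hXm p).2 (Finset.mem_erase.2 ⟨hpx, hp⟩), hp'⟩
    · exact ⟨p, q, hpq, hps, hqs, (hRt p q hpqX).mono ⟨_, _, rfl⟩⟩
  · obtain ⟨X, hXd, hXl, hXm, p, q, hpq, hps, hqs, hpqX⟩ := exists_order hxz
      (headH _ _ hu) (headH _ _ hv) (by omega) s
    obtain ⟨R, hR, hRm, hRt⟩ := exists_path_heads hab hA X x z _ _ hXd hXl
      (fun p hp => hX p ((hXm p).1 hp)) hu hv hodd
    refine ⟨R, hR, fun w => ?_, ?_⟩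
    · rw [hRm, and_iff_left_iff_imp]
      intro hw
      rcases w with _ | ⟨y, w⟩
      · exact absurd hw.2.1.symm hne.ne_empty
      · exact ⟨y, (hXm y).2 (headH _ _ hw), rfl⟩
    · exact ⟨p, q, hpq, hps, hqs, hRt p q hpqX⟩

/-! ### Base cases by computation on stored routes -/

/-- Interchange of the entries in positions `k` and `k + 1`. -/
def swapAt : ℕ → List ℕ → List ℕ
  | 0, x :: y :: l => y :: x :: l
  | k + 1, x :: l => x :: swapAt k l
  | _, l => l

/-- The words met from `w` on by `k` interchanges, whose positions are the base `m` digits of `c`. -/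
def route (m : ℕ) : ℕ → ℕ → List ℕ → List (List ℕ)
  | 0, _, w => [w]
  | k + 1, c, w => w :: route m k (c / m) (swapAt (c % m) w)

/-- A test that a list has no repetitions and no entry among the binary digits set in `s`. -/
def distinct : List ℕ → ℕ → Bool
  | [], _ => true
  | k :: l, s => !s.testBit k && distinct l (s ||| 1 <<< k)

/-- A test that the first entry changes once from and to symbols other than `s`. -/
def turnsAway (s : ℕ) : List (List ℕ) → Bool
  | (x :: _) :: (y :: q) :: P => (x != y && x != s && y != s) || turnsAway s ((y :: q) :: P)
  | _ => false

/-- The words of `n` symbols in which `b` does not precede `a`. -/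
def wordList (n a b : ℕ) : List (List ℕ) :=
  (List.range n).permutations'.filter fun w => !([b, a].isSublist w)

/-- A test that `P` lists the words of `n` symbols in which `b` does not precede `a`, with enough
changes of the first entry. -/
def isTour (n a b : ℕ) (P : List (List ℕ)) : Bool :=
  distinct (P.map fun w => w.foldl (fun k x => k * 8 + x) 0) 0 &&
    P.all (fun w => !([b, a].isSublist w)) && (P.length == (wordList n a b).length) &&
    (List.range (n + 1)).all fun s => turnsAway s P

/-- A test that `codes` describe routes from `range n` to all words of opposite parity. -/
def areRoutes (n a b : ℕ) (codes : List ℕ) : Bool :=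
  let routes := codes.map fun c =>
    route (n - 1) ((wordList n a b).length - 1) c (List.range n)
  routes.all (isTour n a b) && (routes.map (·.getLast?) ==
    ((wordList n a b).filter fun w => inv w % 2 == 1).map some)

theorem swapAt_adj : ∀ (k : ℕ) (w : List ℕ), k + 1 < w.length → Adj w (swapAt k w)
  | 0, x :: y :: l, _ => .swap x y l
  | k + 1, x :: l, h => .cons x (swapAt_adj k l (by simpa using h))
  | 0, [], h | 0, [_], h | _ + 1, [], h => by simp at h

theorem head?_route (m k c : ℕ) (w : List ℕ) : (route m k c w).head? = some w := by
  cases k <;> rfl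

theorem isChain_route {m : ℕ} (hm : 0 < m) : ∀ (k c : ℕ) (w : List ℕ), w.length = m + 1 →
    (route m k c w).IsChain Adj ∧ ∀ v ∈ route m k c w, v.Perm w
  | 0, c, w, _ => by simp [route]
  | k + 1, c, w, hw => by
    have hadj := swapAt_adj (c % m) w (by have := Nat.mod_lt c hm; omega)
    obtain ⟨h₁, h₂⟩ := isChain_route hm k (c / m) (swapAt (c % m) w)
      (hadj.perm.length_eq.symm.trans hw)
    refine ⟨?_, ?_⟩
    · rw [route, List.isChain_cons, head?_route]
      refine ⟨?_, h₁⟩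
      rintro _ ⟨⟩
      exact hadj
    · intro v hv
      rw [route, List.mem_cons] at hv
      rcases hv with rfl | hv
      · exact .refl _
      · exact (h₂ v hv).trans hadj.perm.symm

theorem nodup_of_distinct : ∀ (l : List ℕ) (s : ℕ), distinct l s = true →
    l.Nodup ∧ ∀ k ∈ l, s.testBit k = false
  | [], _, _ => by simp
  | k :: l, s, h => by
    simp only [distinct, Bool.and_eq_true, Bool.not_eq_true'] at h
    obtain ⟨h₁, h₂⟩ := nodup_of_distinct l _ h.2
    simp only [Nat.testBit_or, Bool.or_eq_false_iff] at h₂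
    refine ⟨List.nodup_cons.2 ⟨fun hk => ?_, h₁⟩, ?_⟩
    · simpa [Nat.testBit_shiftLeft] using (h₂ k hk).2
    · rintro j (_ | ⟨_, hj⟩)
      exacts [h.1, (h₂ j hj).1]

theorem exists_turns_of_turnsAway (s : ℕ) : ∀ P : List (List ℕ), turnsAway s P = true →
    ∃ x y, x ≠ y ∧ x ≠ s ∧ y ≠ s ∧ Turns P x y
  | (x :: p) :: (y :: q) :: P, h => by
    simp only [turnsAway, Bool.or_eq_true, Bool.and_eq_true, bne_iff_ne] at h
    rcases h with h | h
    · exact ⟨x, y, h.1.1, h.1.2, h.2, p, q, [], P, rfl⟩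
    · obtain ⟨x, y, h₁, h₂, h₃, h₄⟩ := exists_turns_of_turnsAway s _ h
      exact ⟨x, y, h₁, h₂, h₃, h₄.mono (List.suffix_cons _ _).isInfix⟩
  | [], h | [_], h | [] :: _, h | (_ :: _) :: [] :: _, h => by simp [turnsAway] at h

theorem mem_wordList {n : ℕ} :
    w ∈ wordList n a b ↔ w.Perm (List.range n) ∧ ¬ [b, a].Sublist w := by
  rw [wordList, List.mem_filter, List.mem_permutations', Bool.not_eq_true',
    ← Bool.not_eq_true, List.isSublist_iff_sublist]

theorem exists_route {n : ℕ} (hn : 2 ≤ n) {codes : List ℕ} (h : areRoutes n a b codes = true)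
    (hv : v.Perm (List.range n)) (hab : ¬ [b, a].Sublist v) (hodd : inv v % 2 = 1) :
    ∃ P, IsPath (List.range n) v P ∧
      (∀ w, w ∈ P ↔ w.Perm (List.range n) ∧ ¬ [b, a].Sublist w) ∧
      ∀ s ≤ n, ∃ x y, x ≠ y ∧ x ≠ s ∧ y ≠ s ∧ Turns P x y := by
  simp only [areRoutes, Bool.and_eq_true, beq_iff_eq, List.all_eq_true] at h
  obtain ⟨h₁, h₂⟩ := h
  have hmem := List.mem_map_of_mem (f := some) ((List.mem_filter (p := fun w => inv w % 2 == 1)).2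
    ⟨mem_wordList.2 ⟨hv, hab⟩, beq_iff_eq.2 hodd⟩)
  rw [← h₂] at hmem
  obtain ⟨P, hP, hlast⟩ := List.mem_map.1 hmem
  have htour := h₁ P hP
  obtain ⟨c, -, rfl⟩ := List.mem_map.1 hP
  obtain ⟨hchain, hperm⟩ := isChain_route (m := n - 1) (by omega) ((wordList n a b).length - 1) c
    (List.range n) (by rw [List.length_range]; omega)
  generalize hPe : route (n - 1) ((wordList n a b).length - 1) c (List.range n) = P at *
  simp only [isTour, Bool.and_eq_true, beq_iff_eq, List.all_eq_true, Bool.not_eq_true',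
    ← Bool.not_eq_true (List.isSublist _ _), List.isSublist_iff_sublist, List.mem_range] at htour
  obtain ⟨⟨⟨hd, hs⟩, hlen⟩, ht⟩ := htour
  -- Distinct numerical codes force distinct words, so injectivity of the base 8 encoding is not
  -- needed.
  have hnodup := (nodup_of_distinct _ _ hd).1.of_map
  have hsub : P ⊆ wordList n a b := fun w hw => mem_wordList.2 ⟨hperm w hw, hs w hw⟩
  -- A repetition-free list of admissible words that is as long as the full list contains all of
  -- them.
  have hPW := (List.subperm_of_subset hnodup hsub).perm_of_length_le hlen.ge
  refine ⟨P, ⟨hchain, ?_, hlast, hnodup⟩, fun w => ?_, fun s hs => ?_⟩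
  · rw [← hPe, head?_route]
  · rw [hPW.mem_iff, mem_wordList]
  · exact exists_turns_of_turnsAway s P (ht s (by omega))

/-- Routes from `0123` to the words of opposite parity, among all words of four symbols. -/
def routesFour : List ℕ := [
  35719850459, 11898634043, 71899514996, 18837140054, 38795266416, 56618972265, 18369400746,
  12931871420, 23084522309, 35539372717, 11898634029, 55308970280]

/-- Routes from `01234` to the words of opposite parity, among the words in which `a` precedes
`b`. -/
def routesFive : ℕ → ℕ → List ℕ
  | 0, 1 => [
    267800952219971794276702842901870523, 178776946210705253290429171231917806,
    285214268267617674571813305517291246, 89468051321801843866498346093398839,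
    133554242926714152312931559045560763, 296965628653108264006356183096380526,
    257377724879788969130065032236872571, 294484468406132351734311614227887854,
    33387768488593413813109210756659131, 233134641001292124465084694433307447,
    289300595200836190462920101659876151, 294516455138327894962916329766045422,
    189643443560322910554052504838765469, 142649262754741539964315203775423686,
    159788343026367529337648655938514662, 49581528307716603647163382032283579,
    128663755267690971192705711013438238, 64996415286251747239748928134866875,
    288528929219972573037082862313465030, 130176905543085664176520774232520430,
    64765700702194308651167853617198622, 286717573136999036028549462699050939,
    160561610073213982327884104816342971, 258809523965782686576760016171747054,
    296980697065260831467466900725902558, 294523210039394351521068075363972846,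
    134203094502245365316960707576836987, 153528469124164835990993387163170542,
    32703032286857107637339254935992046, 201813611036161339359650962127342702]
  | 0, 2 => [
    182449441170622492282377384057423389, 310012216070928069347426231783603084,
    237832899697569021730056035183500108, 286175801673250080245581316294777625,
    292237148314506338718040678433584307, 71674052848552435267432667367786348,
    240268943771412782376242563843066732, 237833683325347542031468551121386316,
    130359617374005646859239238356452492, 230863085793878791171701028108614476,
    267150098285899903513748570863508409, 99049507671107498014833875684477725,
    45820632865352277713935144458066873, 49528133274427462901894186819361721,
    92725124904846404444825051746474937, 151696539915040392966112504464207462,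
    203991056638684150197291599993708269, 243481697442029626663557819763231116,
    68187173744304414483418609690852172, 184722769443200584992863244639318905,
    140792632829930297177311880336952093, 300202250686037995368143091839852269,
    198210969337768592728518787523394380, 31535167825584169230824315656059724,
    267316392334480329592142080624925597, 93808769194400787759704247199538790,
    140561097321126742192665038848244556, 130397025554923182532260222954093388,
    32619543661894055216621894420208413, 182416363667627883224978017972067257]
  | 0, 3 => [
    231555540830778822546493019702328246, 260742925125771480463118936908569459,
    143908042807033049781939335324900217, 297074166898192148446383591595779656,
    142535146378392519823839196566041010, 151749906533292639147508428256646045,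
    308813913727125561995041423691450184, 267309820889591249756287532792252007,
    133983147369723865789141753631284966, 288762179388166995130621707521223986,
    92532377740561007487416091959652070, 258049126949880973033393709846868443,
    307132589280964119447210817636252488, 202103351347076878629309973585037128,
    299765435258808708548937422460270286, 178543264373008460605702754261036150,
    157194234679878590786476986497527526, 149836799970138786760239207839314491,
    22238742073940542890444902780089545, 286084789334098245046087394676993604,
    267252604696743810595365813689196957, 127598003145898856737134527491748402,
    189641924272160229768976108212435784, 201949770054304253192759227404849588,
    299603017152700813945157711012863389, 238497299510175493663261986012818893,
    141350415566232356568161076787831492, 99048172877651760088984088968709828,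
    238269147829475811023732409851739062, 189319052479777922860335103910026824]
  | 0, 4 => [
    149962081320168400492138477208653106, 45529847827158887547887790215515019,
    46009869438719019311819768931321582, 64544840855994658426274570382822540,
    306948213752918834536327344254210589, 91976155973462574789894310393524697,
    58242895653134404556638371504736072, 92024079617613173398492700486332007,
    23457595058541588563328519711733292, 130174490979744387481554818992776263,
    132996283703997734278383252590075191, 130308228746350195960665094251990628,
    288264258037433151538527920481613896, 267530440214115688430908814033760695,
    260136130097395027012035680430438691, 233152092305300713711852919006509331,
    260631272407396630462566723459009419, 73480481838447436127456793130883511,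
    189281105214980851892831266370002228, 130812863394616587633850867182253879,
    149666525229938738507912450224319788, 74117571079405347312531701526917985,
    232202177320698743887037949802144994, 64811451536371031206176930476770483,
    296957418442258533634497510674427502, 293918460001138028487188168085915547,
    240437101155712624992930720565147425, 237837177255475312110098519294692492,
    65406461616939122162768998449617777, 95010636209550529526466157329298274]
  | 1, 2 => [
    160249055978256315274123505988383011, 143346850138505074441129475431275291,
    35827487110318687653115092897253579, 182517464674170816063835798486236051,
    201494869766110431250467614415270179, 149800319481750757858552616966648699,
    261611668519608275521411540250727195, 94051820518748128002556402652133259,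
    130397657537772384544780491340663251, 201351597441507580766351329047852939,
    306869974001202171390117486180746419, 174466205125506160563567557595057331,
    35172722673448894509951946741728374, 23492448945086605382877101146880283,
    205442703543547225654729539969719154, 308688644508574842577488655922181915,
    128219960875150493751788066225333019, 201989837661013104123110711815801115,
    298741792114274912374102650742356851, 267272807810820085084474984922008459,
    296551267881321420686215129316008731, 203570170177691953279319134943201563,
    180602567995781432643379777434306758, 59851441148855504981728298597454619,
    180578667668819721093505545533622555, 130331653025977916076950652531011300,
    74736155587715110308100475780829979, 23464756927709709936184559739304411,
    141350038187646593905792467522403219, 157764309690229794966409609108601115]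
  | 1, 3 => [
    151248231564578168432415762582269390, 203965953601761711366402756477637521,
    281829505567939219870986848283313742, 240395296537219543732855755168212078,
    297109037938648632724107919629903694, 60838477524626545150341836128864731,
    101647331399539237662670639714472401, 288696706495641461261617428314907374,
    65462405638735067791873490057317175, 134193874165151352171222149623779889,
    149891036737907951451909367746209634, 294819147538029848655532112786375789,
    88771732037916222450628764766779628, 92720496292699706826466509926283575,
    45586662125089191617587544785609838, 45588859056902721686451628067841134,
    97634958736382060264316410098125934, 35845231888660443879020352671650353,
    254791660658740403469318306612047310, 89264433887052957015334924021360462,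
    127814126025006832122380515340790894, 154195925352728586955600416843829681,
    267303424085655375393943274990112462, 94470040433636957289222718882770158,
    258024187649275285089645121173049655, 175985941658884879180448915720452962,
    43610700818871653677074866962722020, 181180568389600762377578758484300241,
    284959226976559584481102895877678958, 188928300430163866669744376080025698]
  | 1, 4 => [
    272441953163925833442408265049389981, 128281837666864783721816978623488630,
    267036020156599098596993610160847074, 197655704176385220573476890397488029,
    88981714153546514702284862937862425, 237835490601894857674718747481739703,
    180572882850163591298438696747733897, 126004827522171227567019848487964231,
    308814550001726542383455079551092462, 99209893571424160001081785107723490,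
    94052315889859634041310479999976674, 65158227343427546596999631461890956,
    141359010206567063687086011321311982, 97914252293861195319156785928392290,
    272362836374433979877739226631901473, 240866109566995161756919312659756772,
    43557261065890459157547157657104840, 299603017152700300291100782192959883,
    258035011433329528032138695417940790, 190947753383199654184322493742387639,
    231204794755781397999675903567794893, 293964095932817866173031503135814882,
    307145281229180411402626076726151990, 296870999332125163128357046952599991,
    204543516923886441518396425594057885, 133609796243126723430810134239885538,
    204545950819836349156516707052514934, 37811870244216182455678553796563230,
    274088658095255229319390483764768327, 274061981509807375228476741704856507]
  | 2, 3 => [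
    289219372897372652000569216434672057, 204574210793264368829073036456068937,
    232972502275523208981758024862942348, 308661686370357956010388583214498956,
    47092841328272639365586128025830508, 201940882588161565127986844014101612,
    296760112475897517900938607788865460, 189169304290110156215771310626204900,
    191556307703744306132070962834600887, 243545030477782137983140707501717220,
    127771382134947131031578535488833252, 198055743629716177902615044744100665,
    92066580262925996724169907366282380, 93810037618902435206262855141049452,
    157841229285833969731607726157959451, 267654782046753568508618720989955212,
    241060415082086011188967935487458124, 298756772454504851230312683721429275,
    286696259298532952977964968696009097, 143175527560743145741927974369213260,
    127761092296008067469891668514102500, 143837388195457036275429247919998060,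
    24407921039844489533377929233931705, 58235204182132581713158266840397892,
    141322400991452876519438878673319652, 281286982849445547739154929094771852,
    243438266622603254943806775701587684, 23009029606650852337226860238620388,
    178136464182237596444316976873924491, 296522785731816950639802538297626907]
  | 2, 4 => [
    174127144635498263119402514997435273, 172363887229430593681639925504033971,
    23873797923445716531311500857888332, 243030023667949017923446732948956386,
    201589551393065956767751927291503686, 23127628855633528254843144684192947,
    130602590617170220978137345801340083, 174309334677722037214014724084614323,
    306945840617026606933457143190578355, 201494842102374100682869602767915831,
    94023208248432123941922546924020147, 91863517386218954023807953009883980,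
    294428088354977506795058596810536162, 97982773038481619560726536755406003,
    130803298290260723779084721421694775, 178610406216244899303065603298616546,
    93830367049067927899914247135245538, 64646118692795296119567093127767110,
    64813198469603443255944166473871079, 268529950970712309380185104026771730,
    157318999124820842948366813612336198, 66105080927283685337846134124897350,
    32741852965009383026393571230500019, 182404084981574340662985518274983138,
    154286034925344034994421345846437043, 268005994423622894227427160940983186,
    243486144559536977620947561496830226, 94609585833539286095554800414649574,
    76726399252178410802494344493810867, 286750397129526267984344606680042269]
  | 3, 4 => [
    93855756996976617363118073364405473, 267103536966978325530847351036917828,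
    42928231473627708723375092838676280, 188521057181210493599172438248968993,
    267253511753993441994485229527046969, 129087786095654411892232908105598670,
    99150220030651295169013856345733188, 142988066756465449192042708304775236,
    64649195853852405544374592068860177, 190940912603979882737133863757263321,
    128655506118247318811966081854945553, 306856126290220303852836641639609233,
    88771647534852902157043605480108504, 199674260267607478796053515669489937,
    160288969958119459149614023169505348, 22316417129061355743746200233785617,
    60862075049730842131591022865783609, 198905106688242647080470978499105569,
    307556396820678532785764538162320161, 180630770538071840870478947910207761,
    153554144611403538960624059287280542, 182413936933936795746672912578976569,
    33380890649944157839176715646606137, 182346688236755955302269882877424840,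
    64779120595535542083230480971806993, 64993569977827920502163436343707921,
    274061366826637027921534696130295876, 309177081668041638166436485415618833,
    310012267329760615202137330534781721, 99215588481411093534610996510275652]
  | _, _ => []

theorem areRoutes_routesFour : areRoutes 4 4 5 routesFour = true := by decide +kernel

theorem areRoutes_routesFive :
    ∀ b < 5, ∀ a < b, areRoutes 5 a b (routesFive a b) = true := by decide +kernel

/-! ### Transfer of the base cases to arbitrary symbols -/

theorem inv_range (n : ℕ) : inv (List.range n) = 0 := by
  induction n with
  | zero => rfl
  | succ n ih =>
    rw [List.range_succ, inv_append_singleton, ih, List.countP_eq_zero.2]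
    intro x hx
    simpa using (List.mem_range.1 hx).le

theorem pair_sublist {l : List ℕ} {i j : ℕ} (hij : i < j) (hj : j < l.length) :
    [l[i], l[j]].Sublist l :=
  List.map_getElem_sublist (l := l) (is := [⟨i, hij.trans hj⟩, ⟨j, hj⟩]) (by simpa using hij)

theorem getD_idxOf (hx : x ∈ u) : u.getD (u.idxOf x) 0 = x := by
  rw [List.getD_eq_getElem _ _ (List.idxOf_lt_length_of_mem hx), List.getElem_idxOf]

theorem idxOf_getD (hu : u.Nodup) {i : ℕ} (hi : i < u.length) : u.idxOf (u.getD i 0) = i := by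
  rw [List.getD_eq_getElem _ _ hi, hu.idxOf_getElem]

theorem map_map_eq_self {f g : ℕ → ℕ} {l : List ℕ} (h : ∀ x ∈ l, g (f x) = x) :
    (l.map f).map g = l := by
  rw [List.map_map]
  exact (List.map_congr_left (g := id) h).trans (List.map_id l)

/-- Paths between words on the symbols `0, …, n - 1` carry over to arbitrary symbols. -/
theorem exists_path_of_relabelling {n a' b' : ℕ} (hn : u.length = n) (hu : IsWord a b A u)
    (hsub : ∀ w, w.Perm (List.range n) →
      ([b, a].Sublist (w.map (u.getD · 0)) ↔ [b', a'].Sublist w))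
    (h : ∀ v, v.Perm (List.range n) → ¬ [b', a'].Sublist v → inv v % 2 = 1 →
      ∃ P, IsPath (List.range n) v P ∧
        (∀ w, w ∈ P ↔ w.Perm (List.range n) ∧ ¬ [b', a'].Sublist w) ∧
        ∀ s ≤ n, ∃ x y, x ≠ y ∧ x ≠ s ∧ y ≠ s ∧ Turns P x y)
    (hv : IsWord a b A v) (hodd : (inv u + inv v) % 2 = 1) (s : ℕ) :
    ∃ P, IsPath u v P ∧ (∀ w, w ∈ P ↔ IsWord a b A w) ∧
      ∃ x y, x ≠ y ∧ x ≠ s ∧ y ≠ s ∧ Turns P x y := by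
  set f : ℕ → ℕ := (u.getD · 0) with hf
  have hgf : ∀ i < n, u.idxOf (f i) = i := fun i hi => idxOf_getD hu.1 (hn ▸ hi)
  have hfu : (List.range n).map f = u := by
    refine List.ext_getElem (by simp [hn]) fun i h₁ h₂ => ?_
    simp [hf, h₂]
  have hlt : ∀ w : List ℕ, w.Perm (List.range n) → ∀ i ∈ w, i < n := fun w hw i hi =>
    List.mem_range.1 (hw.subset hi)
  have hgfw : ∀ w : List ℕ, w.Perm (List.range n) → (w.map f).map (u.idxOf ·) = w :=
    fun w hw => map_map_eq_self fun i hi => hgf i (hlt w hw i hi)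
  have hfgw : ∀ w : List ℕ, w.Perm u → (w.map (u.idxOf ·)).map f = w :=
    fun w hw => map_map_eq_self fun x hx => getD_idxOf (hw.subset hx)
  have hgw : ∀ w : List ℕ, w.Perm u → (w.map (u.idxOf ·)).Perm (List.range n) := by
    intro w hw
    rw [← hgfw _ (.refl (List.range n)), hfu]
    exact hw.map _
  have hword : ∀ w : List ℕ, w.Perm (List.range n) →
      (IsWord a b A (w.map f) ↔ ¬ [b', a'].Sublist w) := by
    intro w hw
    have hp : (w.map f).Perm u := hfu ▸ hw.map f
    rw [IsWord, hsub w hw, hp.nodup_iff, List.toFinset_eq_of_perm _ _ hp]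
    simp [hu.1, hu.2.1]
  have hv' := hgw v (hv.perm hu)
  have hvw := hword _ hv'
  have hpar := inv_map hv'.symm f (hfu ▸ hu.1)
  rw [hfgw v (hv.perm hu)] at hvw hpar
  rw [hfu] at hpar
  have hrange := inv_range n
  obtain ⟨P, hP, hm, ht⟩ := h _ hv' (hvw.1 hv) (by omega)
  refine ⟨P.map (List.map f), ?_, fun w => ?_, ?_⟩
  · have := hP.map (List.map f) (fun _ _ h => h.map f) fun w₁ h₁ w₂ h₂ e => by
      rw [← hgfw w₁ ((hm w₁).1 h₁).1, e, hgfw w₂ ((hm w₂).1 h₂).1]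
    rwa [hfu, hfgw v (hv.perm hu)] at this
  · constructor
    · intro hw
      obtain ⟨w, hwP, rfl⟩ := List.mem_map.1 hw
      exact (hword w ((hm w).1 hwP).1).2 ((hm w).1 hwP).2
    · intro hw
      have hwu := hw.perm hu
      refine List.mem_map.2 ⟨w.map (u.idxOf ·), (hm _).2 ⟨hgw w hwu, ?_⟩, hfgw w hwu⟩
      rwa [← hword _ (hgw w hwu), hfgw w hwu]
  -- If `s` does not occur in `u`, its index is `n`; hence the test for all `s ≤ n`.
  · obtain ⟨x, y, hxy, hxs, hys, w₁, w₂, hw⟩ := ht (u.idxOf s) (hn ▸ List.idxOf_le_length)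
    have hP : ∀ {p}, p ∈ [x :: w₁, y :: w₂] → p.Perm (List.range n) := fun hp =>
      ((hm _).1 (hw.subset hp)).1
    have hx := hgf x (hlt (x :: w₁) (hP (by simp)) x (by simp))
    have hy := hgf y (hlt (y :: w₂) (hP (by simp)) y (by simp))
    refine ⟨f x, f y, fun e => hxy (by rw [← hx, e, hy]), fun e => hxs (by rw [← hx, e]),
      fun e => hys (by rw [← hy, e]), w₁.map f, w₂.map f, hw.map (List.map f)⟩

/-- Relabelling by positions in `u` turns the initial word into `0123`. The symbols `4` and `5` do
not occur there, so they encode the absence of a constraint. -/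
theorem laceable_of_card_eq_four (hA : A.card = 4) (h : a ∈ A → b ∉ A) : Laceable a b A := by
  intro u v hu hv hodd s
  have hlen : u.length = 4 := by rw [← List.toFinset_card_of_nodup hu.1, hu.2.1, hA]
  refine exists_path_of_relabelling (a' := 4) (b' := 5) hlen hu (fun w hw => ?_)
    (fun v h₁ h₂ h₃ => exists_route (by norm_num) areRoutes_routesFour h₁ h₂ h₃) hv hodd s
  refine iff_of_false (fun hs => ?_) fun hs => by simpa using hw.subset (hs.subset (List.mem_cons_self))
  have hp : (w.map (u.getD · 0)).toFinset ⊆ A := by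
    intro x hx
    obtain ⟨i, hi, rfl⟩ := List.mem_map.1 (List.mem_toFinset.1 hx)
    have : i < u.length := by simpa [hlen] using hw.subset hi
    rw [← hu.2.1, List.mem_toFinset]
    simp [this]
  exact h (hp (List.mem_toFinset.2 (hs.subset (by simp)))) (hp (List.mem_toFinset.2 (hs.subset (by simp))))

/-- After relabelling by positions in `u`, the constrained symbols become their positions there, in
increasing order since `u` obeys the constraint. Only the pairs `a < b < 5` therefore need stored
routes. -/
theorem laceable_of_card_eq_five (hab : a ≠ b) (hA : A.card = 5) (ha : a ∈ A) (hb : b ∈ A) :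
    Laceable a b A := by
  intro u v hu hv hodd s
  have hlen : u.length = 5 := by rw [← List.toFinset_card_of_nodup hu.1, hu.2.1, hA]
  rw [← hu.2.1, List.mem_toFinset] at ha hb
  have hlt : u.idxOf a < u.idxOf b := by
    refine (lt_or_gt_of_ne fun e => hab ((List.idxOf_inj ha).1 e)).resolve_right fun h => hu.2.2 ?_
    have := pair_sublist h (List.idxOf_lt_length_of_mem ha)
    rwa [List.getElem_idxOf, List.getElem_idxOf] at this
  refine exists_path_of_relabelling (a' := u.idxOf a) (b' := u.idxOf b) hlen hu (fun w hw => ?_)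
    (fun v h₁ h₂ h₃ => exists_route (by norm_num) (areRoutes_routesFive _
      (hlen ▸ List.idxOf_lt_length_of_mem hb) _ hlt) h₁ h₂ h₃) hv hodd s
  constructor
  · intro h
    have := h.map (u.idxOf ·)
    rwa [map_map_eq_self fun i hi => idxOf_getD hu.1 (hlen ▸ List.mem_range.1 (hw.subset hi))] at this
  · intro h
    have := h.map (u.getD · 0)
    rwa [List.map_cons, List.map_cons, List.map_nil, getD_idxOf ha, getD_idxOf hb] at this

theorem laceable (hab : a ≠ b) : ∀ (n : ℕ) (A : Finset ℕ), A.card = n → 4 ≤ n →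
    (a ∈ A → b ∈ A → 5 ≤ n) → Laceable a b A := by
  intro n
  induction n with
  | zero => intro _ _ h; omega
  | succ n ih =>
    intro A hA hn h
    by_cases hab' : a ∈ A ∧ b ∈ A
    · rcases (h hab'.1 hab'.2).eq_or_lt with h5 | h5
      · exact laceable_of_card_eq_five hab (by omega) hab'.1 hab'.2
      · refine Laceable.step hab (by omega) (fun _ _ => by omega) fun x hx _ => ?_
        exact ih _ (by rw [Finset.card_erase_of_mem hx]; omega) (by omega) fun _ _ => by omega
    · rcases hn.eq_or_lt with h4 | h4
      · exact laceable_of_card_eq_four (by omega) fun ha hb => hab' ⟨ha, hb⟩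
      · refine Laceable.step hab (by omega) (fun ha hb => absurd ⟨ha, hb⟩ hab') fun x hx _ => ?_
        exact ih _ (by rw [Finset.card_erase_of_mem hx]; omega) (by omega) fun ha hb =>
          absurd ⟨Finset.mem_of_mem_erase ha, Finset.mem_of_mem_erase hb⟩ hab'

end Lists

/-! ### Permutations as lists, and the code obtained from a path -/

variable {n : ℕ}

theorem AdjacentInterchange.sign {v w : Word n} (h : AdjacentInterchange v w) :
    Equiv.Perm.sign w = - Equiv.Perm.sign v := by
  obtain ⟨p, q, hpq, hp, hq, hr⟩ := h
  have hne : p ≠ q := by rintro rfl; omega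
  have : w = v * Equiv.swap p q := by
    ext r : 1
    rw [Equiv.Perm.mul_apply]
    by_cases h₁ : r = p
    · rw [h₁, Equiv.swap_apply_left, hp]
    · by_cases h₂ : r = q
      · rw [h₂, Equiv.swap_apply_right, hq]
      · rw [Equiv.swap_apply_of_ne_of_ne h₁ h₂, hr r h₁ h₂]
  rw [this, Equiv.Perm.sign_mul, Equiv.Perm.sign_swap hne, mul_neg_one]

/-- The word as a list of symbols. -/
def toList (w : Word n) : List ℕ := List.ofFn fun p => (w p : ℕ)

theorem toList_injective : Function.Injective (toList (n := n)) := fun _ _ h =>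
  Equiv.ext fun p => Fin.ext (congrFun (List.ofFn_injective h) p)

theorem length_toList (w : Word n) : (toList w).length = n := List.length_ofFn

theorem toList_getElem (w : Word n) (i : ℕ) (h : i < (toList w).length) :
    (toList w)[i] = w ⟨i, by simpa [length_toList] using h⟩ := by simp [toList]

theorem nodup_toList (w : Word n) : (toList w).Nodup :=
  List.nodup_ofFn.2 (Fin.val_injective.comp w.injective)

theorem toFinset_toList (w : Word n) : (toList w).toFinset = Finset.range n := by
  refine Finset.eq_of_subset_of_card_le (fun x hx => ?_) ?_
  · simp only [toList, List.mem_toFinset, List.mem_ofFn] at hx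
    obtain ⟨p, rfl⟩ := hx
    simp
  · rw [List.toFinset_card_of_nodup (nodup_toList w), length_toList, Finset.card_range]

theorem toList_one : toList (1 : Word n) = List.range n :=
  List.ext_getElem (by simp [length_toList]) fun i h₁ h₂ => by simp [toList_getElem]

theorem toList_reversal (w : Word n) : toList (reversal w) = (toList w).reverse := by
  refine List.ext_getElem (by simp [length_toList]) fun i h₁ h₂ => ?_
  rw [length_toList] at h₁
  rw [List.getElem_reverse, toList_getElem, toList_getElem]
  simp only [reversal, Equiv.trans_apply, length_toList]
  congr 2
  ext
  simp [Fin.rev]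
  omega

theorem exists_toList_eq {w : List ℕ} (hd : w.Nodup) (hw : w.toFinset = Finset.range n) :
    ∃ v : Word n, toList v = w := by
  have hlen : w.length = n := by
    rw [← List.toFinset_card_of_nodup hd, hw, Finset.card_range]
  have hlt : ∀ i (h : i < w.length), w[i] < n := fun i h => by
    rw [← Finset.mem_range, ← hw, List.mem_toFinset]; exact List.getElem_mem h
  let f : Fin n → Fin n := fun p => ⟨w[p], hlt p (by omega)⟩
  have hf : Function.Injective f := fun p q h => by
    have := (hd.getElem_inj_iff).1 (Fin.mk.inj h)
    exact Fin.ext this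
  refine ⟨Equiv.ofBijective f (Finite.injective_iff_bijective.1 hf), ?_⟩
  exact List.ext_getElem (by simp [length_toList, hlen]) fun i h₁ h₂ => by
    simp [toList_getElem, f]

theorem adjacentInterchange_of_adj {v w : Word n} (h : Adj (toList v) (toList w)) :
    AdjacentInterchange v w := by
  obtain ⟨l, x, y, r, hv, hw⟩ := h.exists_swap
  have hlen := congrArg List.length hv
  rw [length_toList] at hlen
  simp only [List.length_append, List.length_cons] at hlen
  have hv' : ∀ i (hi : i < n), (v ⟨i, hi⟩ : ℕ) = (l ++ x :: y :: r)[i]'(by simp; omega) := by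
    intro i hi
    simp only [← hv, toList_getElem]
  have hw' : ∀ i (hi : i < n), (w ⟨i, hi⟩ : ℕ) = (l ++ y :: x :: r)[i]'(by simp; omega) := by
    intro i hi
    simp only [← hw, toList_getElem]
  refine ⟨⟨l.length, by omega⟩, ⟨l.length + 1, by omega⟩, rfl, ?_, ?_, fun i h₁ h₂ => ?_⟩
  · ext; rw [hv', hw']; simp
  · ext; rw [hv', hw']; simp
  · have h₁ : (i : ℕ) ≠ l.length := fun e => h₁ (Fin.ext e)
    have h₂ : (i : ℕ) ≠ l.length + 1 := fun e => h₂ (Fin.ext e)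
    obtain ⟨i, hi⟩ := i
    ext
    rw [hv', hw', List.getElem_append, List.getElem_append]
    split
    · rfl
    · obtain ⟨k, hk⟩ : ∃ k, i - l.length = k + 2 := ⟨i - l.length - 2, by simp at h₁ h₂; omega⟩
      simp [hk]

theorem symm_lt_symm {w : Word n} {i j : Fin n} (hij : i ≠ j)
    (h : ¬ [(j : ℕ), (i : ℕ)].Sublist (toList w)) : w.symm i < w.symm j := by
  refine (lt_or_gt_of_ne fun e => hij (w.symm.injective e)).resolve_right fun hlt => h ?_
  have := pair_sublist (l := toList w) hlt (by rw [length_toList]; exact (w.symm i).2)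
  simpa [toList_getElem] using this

theorem not_sublist_swap {w : List ℕ} (hw : w.Nodup) {x y : ℕ} (h : [x, y].Sublist w) :
    ¬ [y, x].Sublist w := by
  have hp : w.Pairwise fun p q => w.idxOf p < w.idxOf q :=
    List.pairwise_iff_getElem.2 fun i j hi hj hij => by
      rwa [hw.idxOf_getElem, hw.idxOf_getElem]
  intro h'
  have h₁ := hp.sublist h
  have h₂ := hp.sublist h'
  simp at h₁ h₂
  omega

theorem pair_sublist_reverse {w : List ℕ} {x y : ℕ} :
    [x, y].Sublist w.reverse ↔ [y, x].Sublist w := by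
  rw [← List.reverse_sublist, List.reverse_reverse]
  rfl

/-- A Hamilton path from `12…n` to `n…312` through the words in which `1` precedes `2`, followed by
its image under reversal, is a reverse Gray code. -/
theorem exists_code (hn : 2 ≤ n) {v : List ℕ} {P : List (List ℕ)} (hP : IsPath (List.range n) v P)
    (hm : ∀ w, w ∈ P ↔ IsWord 0 1 (Finset.range n) w) (hv : Adj v (List.range n).reverse) :
    ∃ c : Fin (n !) → Word n, IsReverseGrayCode c ∧ StartsWithOneBeforeTwo c := by
  have hi : (⟨0, by omega⟩ : Fin n) ≠ ⟨1, by omega⟩ := by simp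
  have hmt : ∀ w : Word n, toList w ∈ P ↔ ¬ [1, 0].Sublist (toList w) := fun w => by
    rw [hm, IsWord, toFinset_toList]
    simp [nodup_toList]
  have hex : ∀ w ∈ P, ∃ x : Word n, toList x = w := fun w hw =>
    exists_toList_eq ((hm w).1 hw).1 ((hm w).1 hw).2.1
  have hlt : ∀ w : Word n, toList w ∈ P → w.symm ⟨0, by omega⟩ < w.symm ⟨1, by omega⟩ :=
    fun w hw => symm_lt_symm hi ((hmt w).1 hw)
  have hgt : ∀ w : Word n, (toList w).reverse ∈ P →
      w.symm ⟨1, by omega⟩ < w.symm ⟨0, by omega⟩ := by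
    intro w hw
    rw [← toList_reversal, hmt, toList_reversal, pair_sublist_reverse] at hw
    exact symm_lt_symm hi.symm hw
  set L := P ++ P.map List.reverse with hL
  have hLpath : IsPath (List.range n) v.reverse L := by
    -- The halves are joined by `hv`. They are disjoint because reversal exchanges the order of the
    -- first two symbols.
    refine hP.append (hP.map List.reverse (fun _ _ h => h.reverse)
      fun _ _ _ _ h => List.reverse_injective h) hv fun w hw hw' => ?_
    obtain ⟨w', h', rfl⟩ := List.mem_map.1 hw'
    obtain ⟨x, rfl⟩ := hex w' h'
    rw [← toList_reversal] at hw
    have h₁ := hgt (reversal x) (by rwa [toList_reversal, List.reverse_reverse])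
    exact (hlt _ hw).asymm h₁
  have hLmem : ∀ w, w ∈ L ↔ ∃ x : Word n, toList x = w := by
    intro w
    rw [hL, List.mem_append, List.mem_map]
    constructor
    · rintro (h | ⟨w, h, rfl⟩)
      · exact hex w h
      · obtain ⟨x, rfl⟩ := hex w h
        exact ⟨reversal x, toList_reversal x⟩
    · rintro ⟨x, rfl⟩
      by_cases h : [1, 0].Sublist (toList x)
      · refine Or.inr ⟨toList (reversal x), (hmt _).2 ?_, ?_⟩
        · rw [toList_reversal, pair_sublist_reverse]
          exact not_sublist_swap (nodup_toList x) h
        · rw [toList_reversal, List.reverse_reverse]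
      · exact Or.inl ((hmt x).2 h)
  have hlen : L.length = n ! := by
    have : L.toFinset = Finset.univ.image (toList (n := n)) := by
      ext w; simp [hLmem]
    rw [← List.toFinset_card_of_nodup hLpath.nodup, this,
      Finset.card_image_of_injective _ toList_injective, Finset.card_univ, Fintype.card_perm,
      Fintype.card_fin]
  have hhalf : n ! / 2 = P.length := by
    rw [← hlen, hL, List.length_append, List.length_map]
    omega
  have hlen₂ : P.length + P.length = n ! := by
    rw [← hlen, hL, List.length_append, List.length_map]
  choose c hc using fun i : Fin (n !) => (hLmem _).1 (List.getElem_mem (hlen.symm ▸ i.2 : i < L.length))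
  have hinj : Function.Injective c := fun i j h => by
    have h := congrArg toList h
    rw [hc, hc] at h
    exact Fin.ext (hLpath.nodup.getElem_inj_iff.1 h)
  have hleft : ∀ i : Fin (n !), ∀ h : (i : ℕ) < P.length, toList (c i) = P[i] := fun i h => by
    rw [hc]; exact List.getElem_append_left h
  have hright : ∀ i : Fin (n !), ∀ k, ∀ h : k < P.length, (i : ℕ) = k + P.length →
      toList (c i) = P[k].reverse := fun i k h e => by
    rw [hc]
    simp only [hL, e]
    rw [List.getElem_append_right (by omega)]
    simp
  refine ⟨c, ⟨⟨?_, fun i j hij => adjacentInterchange_of_adj ?_⟩, fun i j hij => ?_⟩, ?_, ?_⟩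
  · rw [Fintype.bijective_iff_injective_and_card]
    exact ⟨hinj, by rw [Fintype.card_fin, Fintype.card_perm, Fintype.card_fin]⟩
  · rw [hc, hc]
    simp only [hij]
    exact List.isChain_iff_getElem.1 hLpath.chain _ _
  · rw [hhalf] at hij
    have hi : (i : ℕ) < P.length := by have := j.2; omega
    apply toList_injective
    rw [hright j i hi hij, toList_reversal, hleft i hi]
    rfl
  · intro i hi
    apply toList_injective
    rw [hc, toList_one]
    have := hLpath.head
    rw [List.head?_eq_getElem?, List.getElem?_eq_some_iff] at this
    obtain ⟨_, h⟩ := this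
    simpa only [hi] using h
  · rintro ⟨_, _⟩ ⟨_, _⟩ rfl rfl i
    rw [hhalf]
    constructor
    · intro h
      exact hlt _ (hleft i h ▸ List.getElem_mem h)
    · intro h
      by_contra! hle
      have hk : (i : ℕ) - P.length < P.length := by have := i.2; omega
      refine h.asymm (hgt (c i) ?_)
      rw [hright i _ hk (by omega), List.reverse_reverse]
      exact List.getElem_mem hk

/-! ### The parity obstruction -/

theorem sign_revPerm : Equiv.Perm.sign (Fin.revPerm : Equiv.Perm (Fin n)) = (-1) ^ n.choose 2 := by
  have h : ∀ j : Fin n, ∏ i ∈ Finset.Iio j,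
      (if Fin.revPerm i < Fin.revPerm j then (1 : ℤˣ) else -1) = (-1) ^ (j : ℕ) := by
    intro j
    rw [Finset.prod_congr rfl fun i hi => if_neg ?_, Finset.prod_const, Fin.card_Iio]
    simpa using (Finset.mem_Iio.1 hi).le
  rw [Equiv.Perm.sign_eq_prod_prod_Iio, Finset.prod_congr rfl fun j _ => h j,
    Finset.prod_pow_eq_pow_sum, Fin.sum_univ_eq_sum_range (fun i => i), Finset.sum_range_id,
    Nat.choose_two_right]

/-- Raising `n` by 4 adds the even number `4n + 6` to `n.choose 2`, which leaves four residues to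
check. -/
theorem even_choose_two_iff (n : ℕ) : Even (n.choose 2) ↔ n % 4 = 0 ∨ n % 4 = 1 := by
  obtain ⟨m, k, hk, rfl⟩ : ∃ m k, k < 4 ∧ n = 4 * m + k :=
    ⟨n / 4, n % 4, Nat.mod_lt _ (by norm_num), by omega⟩
  induction m with
  | zero => interval_cases k <;> decide
  | succ m ih =>
    have : (4 * (m + 1) + k).choose 2 = (4 * m + k).choose 2 + 2 * (2 * (4 * m + k) + 3) := by
      rw [show 4 * (m + 1) + k = 4 * m + k + 1 + 1 + 1 + 1 by ring]
      simp only [Nat.choose_succ_succ' _ 1, Nat.choose_one_right]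
      ring
    rw [this, Nat.even_add, iff_true_right (even_two_mul _), ih]
    omega

theorem IsReverseGrayCode.even_choose_two {c : Fin (n !) → Word n} (hc : IsReverseGrayCode c)
    (hn : 4 ≤ n) : Even (n.choose 2) := by
  -- Divisibility by 24 makes `n ! / 2` even.
  obtain ⟨k, hk⟩ : 4 ! ∣ n ! := Nat.factorial_dvd_factorial hn
  rw [show 4 ! = 24 from rfl] at hk
  have hpos := n.factorial_pos
  have hsign : ∀ i (hi : i < n !),
      Equiv.Perm.sign (c ⟨i, hi⟩) = (-1) ^ i * Equiv.Perm.sign (c ⟨0, hpos⟩) := by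
    intro i
    induction i with
    | zero => simp
    | succ i ih =>
      intro hi
      rw [(hc.adjacent ⟨i, by omega⟩ ⟨i + 1, hi⟩ rfl).sign, ih, pow_succ]
      simp
  have h := hsign (n ! / 2) (by omega)
  rw [hc.reverse ⟨0, hpos⟩ ⟨n ! / 2, by omega⟩ (by simp), reversal,
    (by rw [Nat.even_iff]; omega : Even (n ! / 2)).neg_one_pow, one_mul,
    Equiv.Perm.sign_trans, sign_revPerm, mul_eq_left] at h
  exact (neg_one_pow_eq_one_iff_even (by decide)).1 h

/-! ### The required path, and the conclusion -/

theorem isWord_range_iff {a b : ℕ} {w : List ℕ} :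
    IsWord a b (Finset.range n) w ↔ w ∈ wordList n a b := by
  rw [mem_wordList, IsWord, ← and_assoc]
  refine and_congr_left fun _ => ⟨fun h => ?_, fun h => ?_⟩
  · exact List.perm_of_nodup_nodup_toFinset_eq h.1 List.nodup_range (h.2.trans (List.toFinset_range n).symm)
  · exact ⟨h.nodup_iff.2 List.nodup_range, by rw [List.toFinset_eq_of_perm _ _ h, List.toFinset_range]⟩

/-- The word `n…312`, with symbols numbered from `0`. -/
def turningWord (n : ℕ) : List ℕ := (List.range' 2 (n - 2)).reverse ++ [0, 1]

theorem range_eq_cons_cons (hn : 2 ≤ n) : List.range n = 0 :: 1 :: List.range' 2 (n - 2) := by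
  obtain ⟨k, rfl⟩ := Nat.exists_eq_add_of_le' hn
  rw [List.range_eq_range', List.range'_succ, List.range'_succ]
  rfl

theorem turningWord_adj (hn : 2 ≤ n) : Adj (turningWord n) (List.range n).reverse := by
  have := (Adj.swap 0 1 []).append_left (List.range' 2 (n - 2)).reverse
  rw [range_eq_cons_cons hn]
  simpa [turningWord] using this

theorem isWord_range (hn : 2 ≤ n) : IsWord 0 1 (Finset.range n) (List.range n) := by
  refine ⟨List.nodup_range, List.toFinset_range n, not_sublist_swap List.nodup_range ?_⟩
  rw [range_eq_cons_cons hn]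
  simp

theorem isWord_turningWord (hn : 2 ≤ n) : IsWord 0 1 (Finset.range n) (turningWord n) := by
  have h := (turningWord_adj hn).perm.trans (List.reverse_perm _)
  have hd := h.nodup_iff.2 List.nodup_range
  exact ⟨hd, by rw [List.toFinset_eq_of_perm _ _ h, List.toFinset_range],
    not_sublist_swap hd (List.sublist_append_right _ _)⟩

theorem exists_path_of_route (hn : 2 ≤ n) (k c : ℕ)
    (hlast : (route (n - 1) k c (List.range n)).getLast? = some (turningWord n))
    (hnodup : (route (n - 1) k c (List.range n)).Nodup)
    (hperm : (route (n - 1) k c (List.range n)).Perm (wordList n 0 1)) :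
    ∃ P, IsPath (List.range n) (turningWord n) P ∧
      ∀ w, w ∈ P ↔ IsWord 0 1 (Finset.range n) w :=
  ⟨_, ⟨(isChain_route (by omega) k c _ (by rw [List.length_range]; omega)).1, head?_route _ _ _ _,
    hlast, hnodup⟩, fun w => by rw [hperm.mem_iff, isWord_range_iff]⟩

theorem exists_path (hn : 2 ≤ n) (h : n ≤ 4 ∨ n % 4 = 0 ∨ n % 4 = 1) :
    ∃ P, IsPath (List.range n) (turningWord n) P ∧
      ∀ w, w ∈ P ↔ IsWord 0 1 (Finset.range n) w := by
  by_cases h4 : n ≤ 4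
  -- The routes take `n ! / 2 - 1` interchanges, namely 0, 2 and 11; their positions are the digits
  -- of the last number in base `n - 1`, least significant first.
  · interval_cases n
    · exact exists_path_of_route hn 0 0 (by decide) (by decide) (by decide)
    · exact exists_path_of_route hn 2 1 (by decide) (by decide) (by decide)
    · exact exists_path_of_route hn 11 34565 (by decide) (by decide) (by decide)
  · have heven := (even_choose_two_iff n).2 (h.resolve_left h4)
    -- The word `n…321` has `n.choose 2` inversions, an even number, so its neighbour `n…312` is
    -- odd, opposite to `12…n`.
    have h₁ := (turningWord_adj hn).inv (isWord_turningWord hn).1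
    have h₂ := inv_reverse (List.nodup_range (n := n))
    have h₃ := inv_range n
    rw [List.length_range] at h₂
    rw [Nat.even_iff] at heven
    obtain ⟨P, hP, hm, -⟩ := laceable zero_ne_one n (Finset.range n) (Finset.card_range n) (by omega)
      (fun _ _ => by omega) _ _ (isWord_range hn) (isWord_turningWord hn) (by omega) 0
    exact ⟨P, hP, hm⟩

theorem exists_reverseGrayCode (h : n ≤ 4 ∨ n % 4 = 0 ∨ n % 4 = 1) :
    ∃ c : Fin (n !) → Word n, IsReverseGrayCode c ∧ StartsWithOneBeforeTwo c := by
  by_cases hn : 2 ≤ n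
  · obtain ⟨P, hP, hm⟩ := exists_path hn h
    exact exists_code hn hP hm (turningWord_adj hn)
  · have hfac : n ! = 1 := Nat.factorial_eq_one.2 (by omega)
    have : Subsingleton (Fin n) := Fin.subsingleton_iff_le_one.2 (by omega)
    have : Subsingleton (Fin (n !)) := Fin.subsingleton_iff_le_one.2 hfac.le
    refine ⟨fun _ => 1, ⟨⟨⟨Function.injective_of_subsingleton _, fun w =>
      ⟨⟨0, n.factorial_pos⟩, Subsingleton.elim _ _⟩⟩, fun i j hij => ?_⟩,
      fun _ _ _ => Subsingleton.elim _ _⟩, fun _ _ => rfl, fun one two h₁ h₂ => ?_⟩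
    · exact absurd (congrArg Fin.val (Subsingleton.elim i j)) (by omega)
    · exact absurd (congrArg Fin.val (Subsingleton.elim one two)) (by omega)

end ReverseGray

theorem mainTheorem1 (n : ℕ) :
    ((∃ c : Fin (n !) → ReverseGray.Word n, ReverseGray.IsReverseGrayCode c) ↔
      (n ≤ 4 ∨ n ≡ 0 [MOD 4] ∨ n ≡ 1 [MOD 4])) ∧
    ((n ≤ 4 ∨ n ≡ 0 [MOD 4] ∨ n ≡ 1 [MOD 4]) →
      ∃ c : Fin (n !) → ReverseGray.Word n,
        ReverseGray.IsReverseGrayCode c ∧ ReverseGray.StartsWithOneBeforeTwo c) := by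
  refine ⟨⟨fun ⟨c, hc⟩ => ?_, fun h => ?_⟩, ReverseGray.exists_reverseGrayCode⟩
  · by_cases hn : n ≤ 4
    · exact Or.inl hn
    · exact Or.inr ((ReverseGray.even_choose_two_iff n).1 (hc.even_choose_two (by omega)))
  · obtain ⟨c, hc, -⟩ := ReverseGray.exists_reverseGrayCode h
    exact ⟨c, hc⟩
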